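/- Let $Q$ be a convex cyclic quadrilateral in the Euclidean plane whose consecutive side lengths $a,b,c,d$ and area $n$ are rational numbers, and put $$\alpha=\frac{a^2+b^2-c^2+d^2}{2}.$$ Then the equation $$E_{\alpha,-n^2}:\quad y^2=x^3+\alpha x^2-n^2x$$ defines an elliptic curve over $\mathbb{Q}$ (i.e. it is nonsingular), and $$P_1=\left(\frac{(a+c)^2-(b-d)^2}{4},\; a\,\frac{(a+c)^2-(b-d)^2}{4}\right),\qquad P_2=\left(-\frac{(a+d)^2-(b-c)^2}{4},\; b\,\frac{(a+d)^2-(b-c)^2}{4}\right)$$ are two distinct rational points on it, neither of which has order $2$. Conversely, let $\alpha$ and $n>0$ be rational numbers such that the elliptic curve $E_{\alpha,-n^2}:y^2=x^3+\alpha x^2-n^2x$ has positive rank over $\mathbb{Q}$. Then there is a convex cyclic quadrilateral with rational consecutive side lengths $a,b,c,d$ and area $n$ such that $\alpha=\frac{a^2+b^2-c^2+d^2}{2}$, i.e. whose associated curve is the given one. -/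

import Mathlib

/-- The Euclidean plane. -/
abbrev EPlane : Type := EuclideanSpace ℝ (Fin 2)

/-- `Q` is a (convex) cyclic quadrilateral with consecutive vertices `Q 0, Q 1, Q 2, Q 3`:
consecutive vertices are distinct, all vertices lie on one circle, and the two diagonals cross at
a point interior to both of them (so the vertices are listed in their order around the circle). -/
structure IsCyclicQuadrilateral (Q : Polygon EPlane 4) : Prop where
  nondegenerate : Q.HasNondegenerateEdges
  concyclic : EuclideanGeometry.Cospherical (Set.range Q.vertices)
  diagonals_cross : ∃ p : EPlane, Sbtw ℝ (Q 0) p (Q 2) ∧ Sbtw ℝ (Q 1) p (Q 3)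

/-- The area of the convex quadrilateral `Q`: the Lebesgue measure of the region it bounds, which
is the convex hull of its vertices. -/
noncomputable def quadArea (Q : Polygon EPlane 4) : ℝ :=
  (MeasureTheory.volume (convexHull ℝ (Set.range Q.vertices))).toReal

/-- `Q` is a cyclic quadrilateral whose consecutive sides have the rational lengths `a, b, c, d`
and whose area is the rational number `n`. -/
structure IsHeronQuadrilateral (Q : Polygon EPlane 4) (a b c d n : ℚ) : Prop where
  cyclic : IsCyclicQuadrilateral Q
  side_a : dist (Q 0) (Q 1) = (a : ℝ)
  side_b : dist (Q 1) (Q 2) = (b : ℝ)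
  side_c : dist (Q 2) (Q 3) = (c : ℝ)
  side_d : dist (Q 3) (Q 0) = (d : ℝ)
  area : quadArea Q = (n : ℝ)

/-- The curve `y² = x³ + α x² - n² x` over `ℚ`. -/
def heronCurve (α n : ℚ) : WeierstrassCurve.Affine ℚ where
  a₁ := 0
  a₂ := α
  a₃ := 0
  a₄ := -n ^ 2
  a₆ := 0

/-- The coefficient `α` attached to a quadrilateral with consecutive sides `a, b, c, d`. -/
def heronAlpha (a b c d : ℚ) : ℚ := (a ^ 2 + b ^ 2 - c ^ 2 + d ^ 2) / 2

/-- The `x`-coordinate of the first point attached to the quadrilateral. -/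
def heronX₁ (a b c d : ℚ) : ℚ := ((a + c) ^ 2 - (b - d) ^ 2) / 4

/-- The `y`-coordinate of the first point attached to the quadrilateral. -/
def heronY₁ (a b c d : ℚ) : ℚ := a * (((a + c) ^ 2 - (b - d) ^ 2) / 4)

/-- The `x`-coordinate of the second point attached to the quadrilateral. -/
def heronX₂ (a b c d : ℚ) : ℚ := -(((a + d) ^ 2 - (b - c) ^ 2) / 4)

/-- The `y`-coordinate of the second point attached to the quadrilateral. -/
def heronY₂ (a b c d : ℚ) : ℚ := b * (((a + d) ^ 2 - (b - c) ^ 2) / 4)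

/-! Forward direction: with semiperimeter `s`, the abscissas are `(s-b)(s-d)` and `-(s-b)(s-c)`.
Brahmagupta's formula, obtained from Ptolemy and the cross product of the diagonals, turns the curve
equation into a polynomial identity. The factors `s-b`, `s-c`, `s-d` are positive, so the points
have abscissas of opposite signs and nonzero ordinates.

Converse: it suffices to find a quadrilateral with sides `a, a, c, d`. If `a = y / x` is the slope
of a point and `g = x + n² / x`, then `g² = (a² - α)² + 4n²`; for such `a` and `g`, the conditions
on area and `α` are solved by rational `c`, `d`, which are positive once `0 < a` and `a² < n`. So
small positive slopes are needed. Positive rank gives infinitely many slopes, and the subtraction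
law makes them accumulate at `0`: were they bounded away from `0`, two close slopes would produce a
huge one, and subtracting a huge slope repeatedly would lower a fixed one past the bound
(`exists_small_mem_heronSlopes`). -/

/-- The slopes `y / x` of the points of `heronCurve α n`, described as the rational numbers `a` for
which the quartic `(a² - α)² + 4n²` is a square. -/
def heronSlopes (α n : ℚ) : Set ℚ := {a | ∃ g : ℚ, g ^ 2 = (a ^ 2 - α) ^ 2 + 4 * n ^ 2}

theorem exists_pos_of_mem_heronSlopes {α n a : ℚ} (hn : 0 < n) (ha : a ∈ heronSlopes α n) :
    ∃ g : ℚ, 2 * n ≤ g ∧ |a ^ 2 - α| ≤ g ∧ g ≤ a ^ 2 + (|α| + 2 * n) ∧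
      g ^ 2 = (a ^ 2 - α) ^ 2 + 4 * n ^ 2 := by
  obtain ⟨g, hg⟩ := ha
  have h0 := abs_nonneg g
  have h1 := abs_nonneg (a ^ 2 - α)
  have h2 : |a ^ 2 - α| ≤ a ^ 2 + |α| := by
    rw [abs_le]
    constructor <;> linarith [le_abs_self α, neg_abs_le α, sq_nonneg a]
  have hg' : |g| ^ 2 = |a ^ 2 - α| ^ 2 + 4 * n ^ 2 := by rw [sq_abs, sq_abs, hg]
  refine ⟨|g|, ?_, ?_, ?_, by rw [sq_abs, hg]⟩
  · rw [← pow_le_pow_iff_left₀ (by positivity) h0 two_ne_zero, hg']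
    linarith [sq_nonneg |a ^ 2 - α|]
  · rw [← pow_le_pow_iff_left₀ h1 h0 two_ne_zero, hg']
    linarith [sq_nonneg n]
  · have h3 : |g| ≤ |a ^ 2 - α| + 2 * n := by
      rw [← pow_le_pow_iff_left₀ h0 (by positivity) two_ne_zero, hg']
      linarith [mul_nonneg h1 hn.le]
    linarith

theorem neg_mem_heronSlopes {α n a : ℚ} (ha : a ∈ heronSlopes α n) : -a ∈ heronSlopes α n := by
  simpa [heronSlopes] using ha

/-- The subtraction law of the Jacobi quartic `g² = (a² - α)² + 4n²`. -/
theorem sub_mem_heronSlopes {α n a b g h : ℚ} (hg : g ^ 2 = (a ^ 2 - α) ^ 2 + 4 * n ^ 2)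
    (hh : h ^ 2 = (b ^ 2 - α) ^ 2 + 4 * n ^ 2) (hab : b ^ 2 - a ^ 2 ≠ 0) :
    (a * h - b * g) / (b ^ 2 - a ^ 2) ∈ heronSlopes α n := by
  -- The witness is the second coordinate in the subtraction law. The two quartic equations then
  -- eliminate `n ^ 2` and all powers of `h` above the first.
  refine ⟨((a ^ 2 + b ^ 2) * (g * h + 2 * α * a * b)
    - 2 * a * b * (a ^ 2 * b ^ 2 + (α ^ 2 + 4 * n ^ 2))) / (b ^ 2 - a ^ 2) ^ 2, ?_⟩
  have hg2 : n ^ 2 = (g ^ 2 - (a ^ 2 - α) ^ 2) / 4 := by linarith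
  have hh2 : h ^ 2 = (b ^ 2 - α) ^ 2 + g ^ 2 - (a ^ 2 - α) ^ 2 := by linarith
  have hh3 : h ^ 3 = h * ((b ^ 2 - α) ^ 2 + g ^ 2 - (a ^ 2 - α) ^ 2) := by rw [← hh2]; ring
  have hh4 : h ^ 4 = ((b ^ 2 - α) ^ 2 + g ^ 2 - (a ^ 2 - α) ^ 2) ^ 2 := by rw [← hh2]; ring
  rw [hg2]
  field_simp
  ring_nf
  simp only [hh2, hh3, hh4]
  ring

/-- Bounded positive slopes would contain two, `a < b`, arbitrarily close together. Then `(a h + b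
g) / (b² - a²)` has numerator at least `4 ε n` and a tiny denominator, which violates the bound. -/
theorem exists_lt_mem_heronSlopes {α n ε : ℚ} (hn : 0 < n) (hε : 0 < ε)
    (hinf : (heronSlopes α n).Infinite) (hmin : ∀ a ∈ heronSlopes α n, 0 < a → ε ≤ a) (M : ℚ) :
    ∃ a ∈ heronSlopes α n, M < a := by
  by_contra! hM
  set P : Set ℚ := heronSlopes α n ∩ Set.Ioi 0
  have hP : P.Infinite := by
    intro hfin
    refine hinf (((hfin.union (Set.finite_singleton 0)).union
      (hfin.image (fun x => -x))).subset fun a ha => ?_)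
    rcases lt_trichotomy a 0 with h | h | h
    · exact Or.inr ⟨-a, ⟨neg_mem_heronSlopes ha, by simpa using h⟩, by simp⟩
    · exact Or.inl (Or.inr h)
    · exact Or.inl (Or.inl ⟨ha, h⟩)
  obtain ⟨e, he⟩ := hP.nonempty
  have hM0 : 0 < M := lt_of_lt_of_le he.2 (hM e he.1)
  -- Chosen so that `b - a < δ` forces `M (b² - a²) ≤ 2 ε n`, half the lower bound on the numerator.
  set δ : ℚ := ε * n / M ^ 2
  have hδ : 0 < δ := by positivity
  have hmaps : Set.MapsTo (fun a : ℚ => ⌊a / δ⌋) P (Set.Icc 0 ⌊M / δ⌋) := by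
    intro a ha
    refine ⟨Int.floor_nonneg.2 (div_nonneg (le_of_lt ha.2) hδ.le), Int.floor_le_floor ?_⟩
    have := hM a ha.1
    gcongr
  obtain ⟨a, ha, b, hb, hne, hfl⟩ := hP.exists_ne_map_eq_of_mapsTo hmaps (Set.finite_Icc _ _)
  wlog hab : a < b generalizing a b
  · exact this b hb a ha hne.symm hfl.symm (lt_of_le_of_ne (not_lt.1 hab) hne.symm)
  have hlt : b - a < δ := by
    have := Int.abs_sub_lt_one_of_floor_eq_floor hfl.symm
    rw [← sub_div, abs_lt, div_lt_one hδ] at this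
    exact this.2
  obtain ⟨g, hg, -, -, hg2⟩ := exists_pos_of_mem_heronSlopes hn ha.1
  obtain ⟨h, hh, -, -, hh2⟩ := exists_pos_of_mem_heronSlopes hn hb.1
  have ha0 := hmin a ha.1 ha.2
  have hb0 := hmin b hb.1 hb.2
  have haM := hM a ha.1
  have hbM := hM b hb.1
  have hD : 0 < b ^ 2 - a ^ 2 := by nlinarith
  -- Replacing `b` by `-b` turns subtraction into addition, so both terms of the numerator are
  -- positive.
  have hmem := hM _ (sub_mem_heronSlopes (a := a) (b := -b) hg2 (by simpa using hh2)
    (by simpa using hD.ne'))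
  rw [neg_sq, div_le_iff₀ hD] at hmem
  have h1 : b ^ 2 - a ^ 2 ≤ δ * (2 * M) := by
    have : b ^ 2 - a ^ 2 = (b - a) * (b + a) := by ring
    rw [this]
    exact mul_le_mul hlt.le (by linarith) (by linarith) hδ.le
  have h2 : M * (δ * (2 * M)) = 2 * (ε * n) := by
    simp only [δ]; field_simp
  have h3 : M * (b ^ 2 - a ^ 2) ≤ 2 * (ε * n) := h2 ▸ mul_le_mul_of_nonneg_left h1 hM0.le
  nlinarith [mul_le_mul ha0 hh (by positivity) (by linarith),
    mul_le_mul hb0 hg (by positivity) (by linarith), mul_pos hε hn]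

/-- If `heronSlopes α n` is infinite then it contains arbitrarily small positive elements. -/
theorem exists_small_mem_heronSlopes {α n ε : ℚ} (hn : 0 < n) (hε : 0 < ε)
    (hinf : (heronSlopes α n).Infinite) : ∃ a ∈ heronSlopes α n, 0 < a ∧ a < ε := by
  by_contra! hmin
  obtain ⟨B, hB, hB0⟩ := exists_lt_mem_heronSlopes hn hε hinf hmin 0
  set K := |α| + 2 * n
  have hK : 0 ≤ K := by positivity
  -- The three summands give, in turn, `B < b`, a decrease of at least `n / b` per step, and
  -- positivity of each difference.
  obtain ⟨b, hb, hbM⟩ := exists_lt_mem_heronSlopes hn hε hinf hmin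
    (B + (B * K + B ^ 3) / n + (|α| + 2 * n) / ε)
  have hb1 : B < b := by
    have : 0 ≤ (B * K + B ^ 3) / n := by positivity
    have : 0 ≤ (|α| + 2 * n) / ε := by positivity
    linarith
  have hb2 : B * K + B ^ 3 < n * b := by
    have h : (B * K + B ^ 3) / n < b := by
      have : 0 ≤ (|α| + 2 * n) / ε := by positivity
      linarith
    rwa [div_lt_iff₀' hn] at h
  have hb3 : |α| + 2 * n < ε * b := by
    have h : (|α| + 2 * n) / ε < b := by
      have : 0 ≤ (B * K + B ^ 3) / n := by positivity
      linarith
    rwa [div_lt_iff₀' hε] at h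
  have hb0 : 0 < b := hB0.trans hb1
  obtain ⟨h, hh, -, hh', hh2⟩ := exists_pos_of_mem_heronSlopes hn hb
  -- Subtracting the fixed large `b` sends a slope in `(0, B]` to a positive slope smaller by at
  -- least `n / b`, because `h` is about `b²` and `g ≥ 2n`. Finitely many steps go below `ε`.
  have descent : ∀ k : ℕ, ∀ a ∈ heronSlopes α n, 0 < a → a ≤ B → a < ε + k * (n / b) → False := by
    intro k
    induction k with
    | zero => intro a ha ha0 _ hk; simp at hk; exact absurd hk (not_lt.2 (hmin a ha ha0))
    | succ k ih =>
      intro a ha ha0 haB hk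
      have haε := hmin a ha ha0
      obtain ⟨g, hg, -, -, hg2⟩ := exists_pos_of_mem_heronSlopes hn ha
      have hab : a < b := haB.trans_lt hb1
      have hD : 0 < b ^ 2 - a ^ 2 := by nlinarith
      have hmem := sub_mem_heronSlopes hg2 hh2 hD.ne'
      have hpos : 0 < a * h + b * g := by
        have := mul_pos ha0 (lt_of_lt_of_le (by positivity) hh)
        have := mul_pos hb0 (lt_of_lt_of_le (by positivity) hg)
        linarith
      have hprod : α ^ 2 + 4 * n ^ 2 < (a * b) ^ 2 := by
        have h1 : |α| + 2 * n < a * b := hb3.trans_le (by gcongr)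
        have h2 : (|α| + 2 * n) ^ 2 < (a * b) ^ 2 := by gcongr
        nlinarith [sq_abs α, abs_nonneg α]
      have hnum : 0 < a * h - b * g := by
        have key : (a * h - b * g) * (a * h + b * g)
            = (b ^ 2 - a ^ 2) * ((a * b) ^ 2 - (α ^ 2 + 4 * n ^ 2)) := by
          linear_combination a ^ 2 * hh2 - b ^ 2 * hg2
        have : 0 < (a * h - b * g) * (a * h + b * g) := by
          rw [key]; exact mul_pos hD (by linarith)
        exact pos_of_mul_pos_left this hpos.le
      have hstep : (a * h - b * g) / (b ^ 2 - a ^ 2) ≤ a - n / b := by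
        rw [div_le_iff₀ hD]
        have e1 : (a - n / b) * (b ^ 2 - a ^ 2) = a * b ^ 2 - a ^ 3 - n * b + n * a ^ 2 / b := by
          field_simp
          ring
        have e2 : 0 ≤ n * a ^ 2 / b := by positivity
        have e3 : a * h ≤ a * (b ^ 2 + K) := by gcongr
        have e4 : b * (2 * n) ≤ b * g := by gcongr
        have e5 : a * K + a ^ 3 ≤ B * K + B ^ 3 := by gcongr
        rw [e1]
        linarith
      have hηpos : 0 < n / b := by positivity
      refine ih _ hmem (div_pos hnum hD) (by linarith) ?_
      push_cast at hk
      linarith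
  obtain ⟨k, hk⟩ := exists_nat_gt ((B - ε) / (n / b))
  rw [div_lt_iff₀ (by positivity)] at hk
  exact descent k B hB hB0 le_rfl (by linarith)


/-! ### Area of a quadrilateral from its diagonals -/

/-- The signed area of the parallelogram spanned by two plane vectors. -/
def planeCross (u v : EPlane) : ℝ := u 0 * v 1 - u 1 * v 0

/-- The kite with vertices `(-s, 0)`, `(1 - s, 0)`, `(0, -t)`, `(0, 1 - t)`. -/
def unitKite (s t : ℝ) : Set EPlane :=
  convexHull ℝ {!₂[-s, 0], !₂[1 - s, 0], !₂[0, -t], !₂[0, 1 - t]}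

/-- The length of the vertical sections of the kite. -/
noncomputable def kiteWidth (s x : ℝ) : ℝ := min (1 + x / s) (1 - x / (1 - s))

/-- The width is a concave function of the abscissa, so the region between the two graphs is convex
and contains the hull; conversely each of its points is an explicit convex combination of three
vertices. -/
theorem mem_unitKite {s t : ℝ} (hs : 0 < s) (hs' : s < 1) (ht : 0 < t) (ht' : t < 1) (z : EPlane) :
    z ∈ unitKite s t ↔ z 1 ∈ Set.Icc (-t * kiteWidth s (z 0)) ((1 - t) * kiteWidth s (z 0)) := by
  have hs1 : 0 < 1 - s := by linarith
  constructor
  · intro hz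
    have hconv : Convex ℝ {z : EPlane |
        z 1 ∈ Set.Icc (-t * kiteWidth s (z 0)) ((1 - t) * kiteWidth s (z 0))} := by
      intro z hz w hw a b ha hb hab
      have hconc : a * kiteWidth s (z 0) + b * kiteWidth s (w 0)
          ≤ kiteWidth s (a * z 0 + b * w 0) := by
        refine le_min ?_ ?_
        · have h1 : kiteWidth s (z 0) ≤ 1 + z 0 / s := min_le_left _ _
          have h2 : kiteWidth s (w 0) ≤ 1 + w 0 / s := min_le_left _ _
          have e : 1 + (a * z 0 + b * w 0) / s = a * (1 + z 0 / s) + b * (1 + w 0 / s) := by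
            obtain rfl : b = 1 - a := by linarith
            ring
          rw [e]; gcongr
        · have h1 : kiteWidth s (z 0) ≤ 1 - z 0 / (1 - s) := min_le_right _ _
          have h2 : kiteWidth s (w 0) ≤ 1 - w 0 / (1 - s) := min_le_right _ _
          have e : 1 - (a * z 0 + b * w 0) / (1 - s)
              = a * (1 - z 0 / (1 - s)) + b * (1 - w 0 / (1 - s)) := by
            obtain rfl : b = 1 - a := by linarith
            ring
          rw [e]; gcongr
      simp only [Set.mem_ofPred_eq, Set.mem_Icc, PiLp.add_apply, PiLp.smul_apply,
        smul_eq_mul] at hz hw ⊢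
      have k1 := mul_le_mul_of_nonneg_left hconc ht.le
      have k2 := mul_le_mul_of_nonneg_left hconc (sub_nonneg.2 ht'.le)
      have z1 := mul_le_mul_of_nonneg_left hz.1 ha
      have z2 := mul_le_mul_of_nonneg_left hz.2 ha
      have w1 := mul_le_mul_of_nonneg_left hw.1 hb
      have w2 := mul_le_mul_of_nonneg_left hw.2 hb
      constructor <;> linarith
    refine convexHull_min ?_ hconv hz
    have k1 : kiteWidth s (-s) = 0 := by
      rw [kiteWidth, min_eq_left] <;> rw [neg_div, div_self hs.ne']
      · ring
      · have : 0 ≤ s / (1 - s) := by positivity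
        rw [neg_div]; linarith
    have k2 : kiteWidth s (1 - s) = 0 := by
      rw [kiteWidth, min_eq_right] <;> rw [div_self hs1.ne']
      · ring
      · have : 0 ≤ (1 - s) / s := by positivity
        linarith
    have k3 : kiteWidth s 0 = 1 := by simp [kiteWidth]
    rintro z (rfl | rfl | rfl | rfl) <;> simp [k1, k2, k3]
  · intro hz
    obtain ⟨h1, h2⟩ := hz
    have hA : !₂[-s, 0] ∈ unitKite s t := subset_convexHull _ _ (by simp)
    have hB : !₂[1 - s, 0] ∈ unitKite s t := subset_convexHull _ _ (by simp)
    have hC : !₂[0, -t] ∈ unitKite s t := subset_convexHull _ _ (by simp)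
    have hD : !₂[0, 1 - t] ∈ unitKite s t := subset_convexHull _ _ (by simp)
    have hcomb : ∀ (w a x : ℝ), 0 ≤ a → a + w = 1 → z 0 = a * x →
        -t * w ≤ z 1 → z 1 ≤ (1 - t) * w →
        !₂[x, 0] ∈ unitKite s t → z ∈ unitKite s t := by
      intro w a x ha haw hx hl hu hX
      have hz' : z = a • !₂[x, 0] + (((1 - t) * w - z 1) • !₂[0, -t]
          + (z 1 + t * w) • !₂[0, 1 - t]) := by
        ext i
        fin_cases i
        · simp [hx]
        · simp; ring
      rw [hz']
      have hC3 := Convex.sum_mem (R := ℝ) (s := unitKite s t) (convex_convexHull ℝ _)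
        (t := (Finset.univ : Finset (Fin 3)))
        (w := ![a, (1 - t) * w - z 1, z 1 + t * w])
        (z := ![!₂[x, 0], !₂[0, -t], !₂[0, 1 - t]])
        (by intro i _; fin_cases i <;> simp <;> linarith)
        (by simp [Fin.sum_univ_three]; linarith)
        (by intro i _; fin_cases i <;> simp [hX, hC, hD])
      simpa [Fin.sum_univ_three, add_assoc] using hC3
    rcases le_total 0 (z 0) with h0 | h0
    · have hw : kiteWidth s (z 0) = 1 - z 0 / (1 - s) := by
        apply min_eq_right
        have : 0 ≤ z 0 / (1 - s) := by positivity
        have : 0 ≤ z 0 / s := by positivity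
        linarith
      exact hcomb (kiteWidth s (z 0)) (z 0 / (1 - s)) (1 - s) (by positivity) (by rw [hw]; ring)
        (by field_simp) h1 h2 hB
    · have hw : kiteWidth s (z 0) = 1 + z 0 / s := by
        apply min_eq_left
        have : z 0 / (1 - s) ≤ 0 := div_nonpos_of_nonpos_of_nonneg h0 hs1.le
        have : z 0 / s ≤ 0 := div_nonpos_of_nonpos_of_nonneg h0 hs.le
        linarith
      exact hcomb (kiteWidth s (z 0)) (- z 0 / s) (-s) (by have := neg_nonneg.2 h0; positivity)
        (by rw [hw]; ring) (by field_simp) h1 h2 hA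

open MeasureTheory in
theorem volume_unitKite {s t : ℝ} (hs : 0 < s) (hs' : s < 1) (ht : 0 < t) (ht' : t < 1) :
    volume (unitKite s t) = ENNReal.ofReal (1 / 2) := by
  have hs1 : 0 < 1 - s := by linarith
  have hcont : Continuous (kiteWidth s) := by unfold kiteWidth; fun_prop
  set K : Set (ℝ × ℝ) := {p | p.2 ∈ Set.Icc (-t * kiteWidth s p.1) ((1 - t) * kiteWidth s p.1)}
  have hKc : IsClosed K := by
    refine (isClosed_le (f := fun p : ℝ × ℝ => -t * kiteWidth s p.1) (by fun_prop)
      continuous_snd).inter (isClosed_le continuous_snd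
      (g := fun p : ℝ × ℝ => (1 - t) * kiteWidth s p.1) (by fun_prop))
  have hmp := (volume_preserving_finTwoArrow ℝ).comp
    (PiLp.volume_preserving_ofLp (Fin 2))
  have hpre : unitKite s t = (MeasurableEquiv.finTwoArrow ∘ WithLp.ofLp) ⁻¹' K := by
    ext z
    rw [mem_unitKite hs hs' ht ht']
    rfl
  rw [hpre, hmp.measure_preimage hKc.measurableSet.nullMeasurableSet, Measure.volume_eq_prod,
    Measure.prod_apply hKc.measurableSet]
  have hslice : ∀ x : ℝ, volume (Prod.mk x ⁻¹' K) = ENNReal.ofReal (kiteWidth s x) := by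
    intro x
    have : Prod.mk x ⁻¹' K = Set.Icc (-t * kiteWidth s x) ((1 - t) * kiteWidth s x) := rfl
    rw [this, Real.volume_Icc]
    congr 1; ring
  simp_rw [hslice]
  have hsupp : ∀ x, ENNReal.ofReal (kiteWidth s x)
      = (Set.Ioc (-s) (1 - s)).indicator (fun x => ENNReal.ofReal (kiteWidth s x)) x := by
    intro x
    by_cases hx : x ∈ Set.Ioc (-s) (1 - s)
    · rw [Set.indicator_of_mem hx]
    · rw [Set.indicator_of_notMem hx, ENNReal.ofReal_eq_zero]
      rcases not_and_or.1 hx with h | h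
      · refine (min_le_left _ _).trans ?_
        have : x / s ≤ -1 := by rw [div_le_iff₀ hs]; linarith
        linarith
      · refine (min_le_right _ _).trans ?_
        have : 1 ≤ x / (1 - s) := by rw [le_div_iff₀ hs1]; linarith
        linarith
  rw [lintegral_congr hsupp, lintegral_indicator measurableSet_Ioc,
    ← ofReal_integral_eq_lintegral_ofReal
      ((hcont.integrableOn_Icc (a := -s) (b := 1 - s)).mono_set Set.Ioc_subset_Icc_self)]
  · congr 1
    rw [← intervalIntegral.integral_of_le (by linarith),
      ← intervalIntegral.integral_add_adjacent_intervals (b := 0)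
        (hcont.intervalIntegrable _ _) (hcont.intervalIntegrable _ _)]
    have i1 : ∫ x in (-s)..0, kiteWidth s x = ∫ x in (-s)..0, (1 + x / s) := by
      refine intervalIntegral.integral_congr fun x hx => ?_
      rw [Set.uIcc_of_le (by linarith)] at hx
      apply min_eq_left
      have : x / (1 - s) ≤ 0 := div_nonpos_of_nonpos_of_nonneg hx.2 hs1.le
      have : x / s ≤ 0 := div_nonpos_of_nonpos_of_nonneg hx.2 hs.le
      linarith
    have i2 : ∫ x in (0 : ℝ)..(1 - s), kiteWidth s x
        = ∫ x in (0 : ℝ)..(1 - s), (1 - x / (1 - s)) := by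
      refine intervalIntegral.integral_congr fun x hx => ?_
      rw [Set.uIcc_of_le (by linarith)] at hx
      apply min_eq_right
      have : 0 ≤ x / (1 - s) := div_nonneg hx.1 hs1.le
      have : 0 ≤ x / s := div_nonneg hx.1 hs.le
      linarith
    rw [i1, i2, intervalIntegral.integral_add (by simp) (by
        exact Continuous.intervalIntegrable (by fun_prop) _ _),
      intervalIntegral.integral_sub (by simp) (by
        exact Continuous.intervalIntegrable (by fun_prop) _ _)]
    simp only [intervalIntegral.integral_div, intervalIntegral.integral_const, integral_id,
      smul_eq_mul]
    field_simp
    ring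
  · refine (ae_restrict_iff' measurableSet_Ioc).2 (Filter.Eventually.of_forall fun x hx => ?_)
    change 0 ≤ kiteWidth s x
    refine le_min ?_ ?_
    · have : -1 ≤ x / s := by rw [le_div_iff₀ hs]; linarith [hx.1]
      linarith
    · have : x / (1 - s) ≤ 1 := by rw [div_le_iff₀ hs1]; linarith [hx.2]
      linarith

open MeasureTheory in
/-- The area of a quadrilateral whose diagonals cross is half the absolute value of the cross
product of the diagonals. -/
theorem quadArea_eq {Q : Polygon EPlane 4}
    (h : ∃ p : EPlane, Sbtw ℝ (Q 0) p (Q 2) ∧ Sbtw ℝ (Q 1) p (Q 3)) :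
    quadArea Q = |planeCross (Q 2 - Q 0) (Q 3 - Q 1)| / 2 := by
  obtain ⟨p, h02, h13⟩ := h
  obtain ⟨-, s, ⟨hs, hs'⟩, hps⟩ := sbtw_iff_mem_image_Ioo_and_ne.1 h02 |>.symm
  obtain ⟨-, t, ⟨ht, ht'⟩, hpt⟩ := sbtw_iff_mem_image_Ioo_and_ne.1 h13 |>.symm
  set u := Q 2 - Q 0 with hu
  set v := Q 3 - Q 1 with hv
  have e0 : Q 0 = p - s • u := by rw [← hps, AffineMap.lineMap_apply, hu]; simp
  have e1 : Q 1 = p - t • v := by rw [← hpt, AffineMap.lineMap_apply, hv]; simp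
  have e2 : Q 2 = p + (1 - s) • u := by
    rw [sub_smul, one_smul, add_sub_left_comm, ← e0, hu]; simp
  have e3 : Q 3 = p + (1 - t) • v := by
    rw [sub_smul, one_smul, add_sub_left_comm, ← e1, hv]; simp
  -- After translation by `p`, the linear map with columns `u`, `v` carries the kite, of area `1 /
  -- 2`, onto the quadrilateral.
  let M : EPlane →ₗ[ℝ] EPlane :=
    Matrix.toLin (EuclideanSpace.basisFun (Fin 2) ℝ).toBasis
      (EuclideanSpace.basisFun (Fin 2) ℝ).toBasis !![u 0, v 0; u 1, v 1]
  have hM : ∀ x y : ℝ, M !₂[x, y] = x • u + y • v := by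
    intro x y
    have hxy : !₂[x, y] = x • (EuclideanSpace.basisFun (Fin 2) ℝ).toBasis 0
        + y • (EuclideanSpace.basisFun (Fin 2) ℝ).toBasis 1 := by
      ext i; fin_cases i <;> simp
    rw [hxy, map_add, map_smul, map_smul, Matrix.toLin_self, Matrix.toLin_self]
    ext i; fin_cases i <;> simp [Fin.sum_univ_two]
  have hdet : LinearMap.det M = planeCross u v := by
    rw [LinearMap.det_toLin, Matrix.det_fin_two_of, planeCross]; ring
  have hrange : Set.range Q.vertices = (fun z => p + z) '' (M ''
      {!₂[-s, 0], !₂[1 - s, 0], !₂[0, -t], !₂[0, 1 - t]}) := by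
    have : Set.range Q.vertices = {Q 0, Q 1, Q 2, Q 3} := by
      ext z; simp [Fin.exists_fin_succ, eq_comm]
    rw [this]
    simp only [Set.image_insert_eq, Set.image_singleton, hM, e0, e1, e2, e3]
    ext z
    simp only [Set.mem_insert_iff, Set.mem_singleton_iff, zero_smul, neg_smul, add_zero, zero_add,
      sub_eq_add_neg]
    tauto
  have hhull : convexHull ℝ (Set.range Q.vertices) = (fun z => p + z) '' (M '' unitKite s t) := by
    rw [hrange, unitKite, M.image_convexHull]
    exact (convexHull_vadd p _)
  rw [quadArea, hhull, Set.image_add_left, measure_preimage_add, Measure.addHaar_image_linearMap,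
    hdet, volume_unitKite hs hs' ht ht', ENNReal.toReal_mul, ENNReal.toReal_ofReal (abs_nonneg _),
    ENNReal.toReal_ofReal (by norm_num)]
  ring

/-! ### Brahmagupta's formula and the metric constraints -/

theorem dist_sq_eq (u v : EPlane) : dist u v ^ 2 = (u 0 - v 0) ^ 2 + (u 1 - v 1) ^ 2 := by
  rw [EuclideanSpace.dist_eq, Real.sq_sqrt (by positivity), Fin.sum_univ_two, Real.dist_eq,
    Real.dist_eq, sq_abs, sq_abs]

/-- Parallel diagonals that meet would make `Q 0`, `Q 1`, `Q 2` collinear, but three distinct points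
of a circle are affinely independent. -/
theorem planeCross_diagonals_ne_zero {Q : Polygon EPlane 4} (h : IsCyclicQuadrilateral Q) :
    planeCross (Q 2 - Q 0) (Q 3 - Q 1) ≠ 0 := by
  intro h0
  obtain ⟨p, h02, h13⟩ := h.diagonals_cross
  obtain ⟨hne, s, -, hps⟩ := sbtw_iff_mem_image_Ioo_and_ne.1 h02 |>.symm
  obtain ⟨-, t, -, hpt⟩ := sbtw_iff_mem_image_Ioo_and_ne.1 h13 |>.symm
  have hind := h.concyclic.affineIndependent_of_mem_of_ne (Set.mem_range_self 0)
    (Set.mem_range_self 1) (Set.mem_range_self 2) (h.nondegenerate 0) hne (h.nondegenerate 1)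
  rw [affineIndependent_iff_not_collinear_set] at hind
  refine hind ((collinear_iff_of_mem (p₀ := Q 0) (by simp)).2 ⟨Q 2 - Q 0, ?_⟩)
  set u := Q 2 - Q 0 with hu
  set v := Q 3 - Q 1 with hv
  have hu0 : u ≠ 0 := sub_ne_zero.2 hne.symm
  have hnorm : u 0 ^ 2 + u 1 ^ 2 ≠ 0 := by
    intro hz
    have hz0 : u 0 = 0 :=
      (pow_eq_zero_iff two_ne_zero).1 (by linarith [sq_nonneg (u 0), sq_nonneg (u 1)])
    have hz1 : u 1 = 0 :=
      (pow_eq_zero_iff two_ne_zero).1 (by linarith [sq_nonneg (u 0), sq_nonneg (u 1)])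
    refine hu0 ?_
    ext i
    fin_cases i
    · exact hz0
    · exact hz1
  have hvu : v = ((u 0 * v 0 + u 1 * v 1) / (u 0 ^ 2 + u 1 ^ 2)) • u := by
    rw [planeCross] at h0
    ext i
    fin_cases i
    · simp only [Fin.zero_eta, PiLp.smul_apply, smul_eq_mul]
      field_simp
      linear_combination -u 1 * h0
    · simp only [Fin.mk_one, PiLp.smul_apply, smul_eq_mul]
      field_simp
      linear_combination u 0 * h0
  have e1 : Q 1 = (s - t * ((u 0 * v 0 + u 1 * v 1) / (u 0 ^ 2 + u 1 ^ 2))) • u + Q 0 := by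
    have : s • u + Q 0 = t • v + Q 1 := by
      rw [AffineMap.lineMap_apply] at hps hpt
      exact hps.trans hpt.symm
    rw [hvu, smul_smul] at this
    rw [sub_smul, sub_add_eq_add_sub, this, add_sub_cancel_left]
  rintro q (rfl | rfl | rfl)
  · exact ⟨0, by simp⟩
  · exact ⟨_, e1⟩
  · exact ⟨1, by simp [hu]⟩

/-- **Brahmagupta's formula**. -/
theorem sq_quadArea_eq {Q : Polygon EPlane 4} (h : IsCyclicQuadrilateral Q) :
    16 * quadArea Q ^ 2 = 4 * (dist (Q 0) (Q 1) * dist (Q 2) (Q 3)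
        + dist (Q 1) (Q 2) * dist (Q 3) (Q 0)) ^ 2
      - (dist (Q 0) (Q 1) ^ 2 - dist (Q 1) (Q 2) ^ 2 + dist (Q 2) (Q 3) ^ 2
        - dist (Q 3) (Q 0) ^ 2) ^ 2 := by
  obtain ⟨p, h02, h13⟩ := h.diagonals_cross
  have hco : EuclideanGeometry.Cospherical ({Q 0, Q 1, Q 2, Q 3} : Set EPlane) := by
    refine h.concyclic.subset ?_
    rintro q (rfl | rfl | rfl | rfl) <;> exact Set.mem_range_self _
  -- Ptolemy replaces the sum of products of opposite sides by the product of the diagonals; the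
  -- rest is an identity in coordinates.
  rw [EuclideanGeometry.mul_dist_add_mul_dist_eq_mul_dist_of_cospherical hco h02.angle₁₂₃_eq_pi
    h13.angle₁₂₃_eq_pi, quadArea_eq ⟨p, h02, h13⟩, div_pow, sq_abs, mul_pow]
  simp only [dist_sq_eq, planeCross, PiLp.sub_apply]
  ring

theorem IsCyclicQuadrilateral.quadArea_pos {Q : Polygon EPlane 4} (h : IsCyclicQuadrilateral Q) :
    0 < quadArea Q := by
  rw [quadArea_eq h.diagonals_cross]
  exact half_pos (abs_pos.2 (planeCross_diagonals_ne_zero h))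

/-- The metric data of a Heron quadrilateral: the sides and the area are positive, each side is
shorter than the sum of the others, and Brahmagupta's formula holds. -/
theorem IsHeronQuadrilateral.metric {Q : Polygon EPlane 4} {a b c d n : ℚ}
    (h : IsHeronQuadrilateral Q a b c d n) :
    0 < n ∧ 0 < a ∧ 0 < b ∧ 0 < b + c + d - a ∧ 0 < a + c + d - b ∧ 0 < a + b + d - c ∧
      0 < a + b + c - d ∧
      16 * n ^ 2 = (b + c + d - a) * (a + c + d - b) * (a + b + d - c) * (a + b + c - d) := by
  have hn : 0 < n := by exact_mod_cast h.area ▸ h.cyclic.quadArea_pos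
  have hbr := sq_quadArea_eq h.cyclic
  have ha : 0 < a := by
    have := dist_pos.2 (h.cyclic.nondegenerate 0)
    exact_mod_cast h.side_a ▸ this
  have hb : 0 < b := by
    have := dist_pos.2 (h.cyclic.nondegenerate 1)
    exact_mod_cast h.side_b ▸ this
  have ta := dist_triangle4 (Q 1) (Q 2) (Q 3) (Q 0)
  have tb := dist_triangle4 (Q 2) (Q 3) (Q 0) (Q 1)
  have tc := dist_triangle4 (Q 3) (Q 0) (Q 1) (Q 2)
  have td := dist_triangle4 (Q 0) (Q 1) (Q 2) (Q 3)
  rw [dist_comm (Q 1) (Q 0)] at ta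
  rw [dist_comm (Q 2) (Q 1)] at tb
  rw [dist_comm (Q 3) (Q 2)] at tc
  rw [dist_comm (Q 0) (Q 3)] at td
  rw [h.side_a, h.side_b, h.side_c, h.side_d] at hbr ta tb tc td
  rw [h.area] at hbr
  norm_cast at hbr ta tb tc td
  have hbr' : 16 * n ^ 2
      = (b + c + d - a) * (a + c + d - b) * (a + b + d - c) * (a + b + c - d) := by
    rw [hbr]; ring
  -- The nonzero area makes the weak polygon inequalities strict.
  have hpos : (b + c + d - a) * (a + c + d - b) * (a + b + d - c) * (a + b + c - d) ≠ 0 := by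
    rw [← hbr']; positivity
  simp only [mul_ne_zero_iff] at hpos
  obtain ⟨⟨⟨h1, h2⟩, h3⟩, h4⟩ := hpos
  exact ⟨hn, ha, hb, lt_of_le_of_ne (by linarith) h1.symm, lt_of_le_of_ne (by linarith) h2.symm,
    lt_of_le_of_ne (by linarith) h3.symm, lt_of_le_of_ne (by linarith) h4.symm, hbr'⟩

/-! ### Construction of the quadrilateral -/

/-- A cyclic quadrilateral with sides `a, a, c, d` and area `p * w`, where `2p = c + d`. -/
theorem exists_cyclicQuadrilateral {a c d p w : ℝ} (ha : 0 < a) (hc : 0 < c) (hd : 0 < d)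
    (hw : 0 < w) (hp : c + d = 2 * p) (hf : a ^ 2 + c * d = p ^ 2 + w ^ 2) :
    ∃ Q : Polygon EPlane 4, IsCyclicQuadrilateral Q ∧ dist (Q 0) (Q 1) = a ∧
      dist (Q 1) (Q 2) = a ∧ dist (Q 2) (Q 3) = c ∧ dist (Q 3) (Q 0) = d ∧
      quadArea Q = p * w := by
  have hp0 : 0 < p := by linarith
  set f := √(p ^ 2 + w ^ 2)
  have hf0 : 0 < f := Real.sqrt_pos.2 (by positivity)
  have hf2 : f ^ 2 = p ^ 2 + w ^ 2 := Real.sq_sqrt (by positivity)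
  -- The diagonal from `Q 3` to `Q 1` has length `f` and, since the sides `a` are equal chords,
  -- bisects the angle at `Q 3`; the other two sides there point along `(p, w)` and `(p, -w)`.
  let Q : Polygon EPlane 4 :=
    ⟨![!₂[d * p / f, -(d * w / f)], !₂[f, 0], !₂[c * p / f, c * w / f], !₂[0, 0]]⟩
  have hQ0 : Q 0 = !₂[d * p / f, -(d * w / f)] := rfl
  have hQ1 : Q 1 = !₂[f, 0] := rfl
  have hQ2 : Q 2 = !₂[c * p / f, c * w / f] := rfl
  have hQ3 : Q 3 = !₂[0, 0] := rfl
  have hdist : ∀ {x y : EPlane} {r : ℝ}, 0 ≤ r → (x 0 - y 0) ^ 2 + (x 1 - y 1) ^ 2 = r ^ 2 →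
      dist x y = r := by
    intro x y r hr hxy
    rw [← dist_sq_eq] at hxy
    exact (pow_left_inj₀ dist_nonneg hr two_ne_zero).1 hxy
  have da : dist (Q 0) (Q 1) = a := by
    apply hdist ha.le
    simp only [hQ0, hQ1, PiLp.toLp_apply, Matrix.cons_val_zero, Matrix.cons_val_one]
    have : (d * p / f - f) ^ 2 + (-(d * w / f) - 0) ^ 2
        = d ^ 2 * (p ^ 2 + w ^ 2) / f ^ 2 - 2 * (d * p) + f ^ 2 := by
      field_simp; ring
    rw [this, ← hf2, mul_div_cancel_right₀ _ (by positivity), hf2]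
    linear_combination -hf + d * hp
  have db : dist (Q 1) (Q 2) = a := by
    apply hdist ha.le
    simp only [hQ1, hQ2, PiLp.toLp_apply, Matrix.cons_val_zero, Matrix.cons_val_one]
    have : (f - c * p / f) ^ 2 + (0 - c * w / f) ^ 2
        = c ^ 2 * (p ^ 2 + w ^ 2) / f ^ 2 - 2 * (c * p) + f ^ 2 := by
      field_simp; ring
    rw [this, ← hf2, mul_div_cancel_right₀ _ (by positivity), hf2]
    linear_combination -hf + c * hp
  have dc : dist (Q 2) (Q 3) = c := by
    apply hdist hc.le
    simp only [hQ2, hQ3, PiLp.toLp_apply, Matrix.cons_val_zero, Matrix.cons_val_one]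
    have : (c * p / f - 0) ^ 2 + (c * w / f - 0) ^ 2 = c ^ 2 * (p ^ 2 + w ^ 2) / f ^ 2 := by
      field_simp; ring
    rw [this, ← hf2, mul_div_cancel_right₀ _ (by positivity)]
  have dd : dist (Q 3) (Q 0) = d := by
    apply hdist hd.le
    simp only [hQ0, hQ3, PiLp.toLp_apply, Matrix.cons_val_zero, Matrix.cons_val_one]
    have : (0 - d * p / f) ^ 2 + (0 - -(d * w / f)) ^ 2 = d ^ 2 * (p ^ 2 + w ^ 2) / f ^ 2 := by
      field_simp; ring
    rw [this, ← hf2, mul_div_cancel_right₀ _ (by positivity)]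
  have hcross : ∃ q : EPlane, Sbtw ℝ (Q 0) q (Q 2) ∧ Sbtw ℝ (Q 1) q (Q 3) := by
    -- By the bisector theorem the crossing point divides the other diagonal in the ratio `d : c`.
    refine ⟨!₂[c * d / f, 0], ?_, ?_⟩
    · refine sbtw_iff_mem_image_Ioo_and_ne.2 ⟨⟨d / (c + d), ⟨by positivity, ?_⟩, ?_⟩, ?_⟩
      · rw [div_lt_one (by positivity)]; linarith
      · rw [hQ0, hQ2, AffineMap.lineMap_apply]
        have hpe : p = (c + d) / 2 := by linarith
        ext i
        fin_cases i
        · simp [hpe]; field_simp; ring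
        · simp; field_simp; ring
      · intro h
        have := congrArg (fun z : EPlane => z 1) h
        simp only [hQ0, hQ2, PiLp.toLp_apply, Matrix.cons_val_one, Matrix.cons_val_zero] at this
        have h1 : 0 < d * w / f := by positivity
        have h2 : 0 < c * w / f := by positivity
        linarith
    · refine sbtw_iff_mem_image_Ioo_and_ne.2 ⟨⟨a ^ 2 / f ^ 2, ⟨by positivity, ?_⟩, ?_⟩, ?_⟩
      · rw [div_lt_one (by positivity), hf2, ← hf]
        have := mul_pos hc hd
        linarith
      · rw [hQ1, hQ3, AffineMap.lineMap_apply]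
        ext i
        fin_cases i
        · simp; field_simp; linear_combination hf2 - hf
        · simp
      · intro h
        have := congrArg (fun z : EPlane => z 0) h
        simp only [hQ1, hQ3, PiLp.toLp_apply, Matrix.cons_val_zero] at this
        exact hf0.ne' this
  -- The center lies on the bisector of `Q 1` and `Q 3`; equidistance from `Q 2` and `Q 3` fixes its
  -- second coordinate.
  refine ⟨Q, ⟨?_, ⟨!₂[f / 2, f * (c - p) / w / 2], √((f / 2) ^ 2 + (f * (c - p) / w / 2) ^ 2),
    ?_⟩, hcross⟩, da, db, dc, dd, ?_⟩
  · intro i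
    rw [← dist_pos]
    fin_cases i
    · exact da ▸ ha
    · exact db ▸ ha
    · exact dc ▸ hc
    · exact dd ▸ hd
  · rintro _ ⟨i, rfl⟩
    apply hdist (Real.sqrt_nonneg _)
    rw [Real.sq_sqrt (by positivity)]
    fin_cases i
    · change ((d * p / f) - f / 2) ^ 2 + (-(d * w / f) - f * (c - p) / w / 2) ^ 2 = _
      have : ((d * p / f) - f / 2) ^ 2 + (-(d * w / f) - f * (c - p) / w / 2) ^ 2
          = d ^ 2 * (p ^ 2 + w ^ 2) / f ^ 2 - d * p + d * (c - p)
            + ((f / 2) ^ 2 + (f * (c - p) / w / 2) ^ 2) := by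
        field_simp; ring
      rw [this, ← hf2, mul_div_cancel_right₀ _ (by positivity)]
      linear_combination d * hp
    · change (f - f / 2) ^ 2 + (0 - f * (c - p) / w / 2) ^ 2 = _
      ring
    · change ((c * p / f) - f / 2) ^ 2 + ((c * w / f) - f * (c - p) / w / 2) ^ 2 = _
      have : ((c * p / f) - f / 2) ^ 2 + ((c * w / f) - f * (c - p) / w / 2) ^ 2
          = c ^ 2 * (p ^ 2 + w ^ 2) / f ^ 2 - c * p - c * (c - p)
            + ((f / 2) ^ 2 + (f * (c - p) / w / 2) ^ 2) := by
        field_simp; ring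
      rw [this, ← hf2, mul_div_cancel_right₀ _ (by positivity)]
      ring
    · change (0 - f / 2) ^ 2 + (0 - f * (c - p) / w / 2) ^ 2 = _
      ring
  · rw [quadArea_eq hcross]
    have : planeCross (Q 2 - Q 0) (Q 3 - Q 1) = 2 * (p * w) := by
      simp only [planeCross, hQ0, hQ1, hQ2, hQ3, PiLp.sub_apply,
        Matrix.cons_val_zero, Matrix.cons_val_one]
      field_simp
      linear_combination f * w * hp
    rw [this, abs_of_pos (by positivity)]
    ring

/-! ### Rational points, slopes and the main theorem -/

open WeierstrassCurve.Affine in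
/-- A positive rank produces infinitely many slopes. -/
theorem infinite_heronSlopes {α n : ℚ} (h : 0 < Module.rank ℤ (heronCurve α n).Point) :
    (heronSlopes α n).Infinite := by
  have hpt : Infinite (heronCurve α n).Point := by
    by_contra hfin
    rw [not_infinite_iff_finite] at hfin
    refine h.ne' (rank_eq_zero_iff.2 fun P => ?_)
    obtain ⟨k, hk, hkP⟩ := (isOfFinAddOrder_of_finite P).exists_nsmul_eq_zero
    exact ⟨k, by exact_mod_cast hk.ne', by simpa using hkP⟩
  intro hfin
  -- A pair `(a, g)` determines `x = (a² - α + g) / 2` and `y = a x`, so finitely many slopes leave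
  -- finitely many points.
  have hT : {p : ℚ × ℚ | p.1 ∈ heronSlopes α n ∧ p.2 ^ 2 = (p.1 ^ 2 - α) ^ 2 + 4 * n ^ 2}.Finite := by
    refine (hfin.biUnion (t := fun a => (fun g => (a, g)) '' {g : ℚ | g ^ 2 = (a ^ 2 - α) ^ 2 + 4 * n ^ 2})
      fun a _ => ?_).subset fun p hp => Set.mem_biUnion hp.1 ⟨p.2, hp.2, rfl⟩
    refine Set.Finite.image _ ?_
    by_cases hne : {g : ℚ | g ^ 2 = (a ^ 2 - α) ^ 2 + 4 * n ^ 2}.Nonempty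
    · obtain ⟨g, hg⟩ := hne
      refine (Set.toFinite {g, -g}).subset fun g' hg' => ?_
      exact sq_eq_sq_iff_eq_or_eq_neg.1 (Eq.trans hg' (Eq.symm hg))
    · rw [Set.not_nonempty_iff_eq_empty.1 hne]; exact Set.finite_empty
  have hxy : {p : ℚ × ℚ | (heronCurve α n).Nonsingular p.1 p.2}.Finite := by
    refine ((hT.image fun p => ((p.1 ^ 2 - α + p.2) / 2, p.1 * ((p.1 ^ 2 - α + p.2) / 2))).union
      (Set.finite_singleton (0, 0))).subset ?_
    rintro ⟨x, y⟩ hp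
    have heq : y ^ 2 = x ^ 3 + α * x ^ 2 - n ^ 2 * x := by
      have := ((heronCurve α n).equation_iff _ _).1 hp.1
      simp only [heronCurve] at this
      linarith
    rcases eq_or_ne x 0 with rfl | hx
    · exact Or.inr (by simpa using heq)
    · have hy : (y / x) ^ 2 - α = x - n ^ 2 / x := by
        rw [div_pow, heq]
        field_simp
        ring
      have hg : (x + n ^ 2 / x) ^ 2 = ((y / x) ^ 2 - α) ^ 2 + 4 * n ^ 2 := by
        rw [hy]; field_simp; ring
      have hx2 : (x - n ^ 2 / x + (x + n ^ 2 / x)) / 2 = x := by ring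
      refine Or.inl ⟨(y / x, x + n ^ 2 / x), ⟨⟨_, hg⟩, hg⟩, ?_⟩
      simp only [hy, hx2, div_mul_cancel₀ y hx]
  have := hxy.to_subtype
  refine hpt.not_finite (Finite.of_surjective
    (fun p : Option {p : ℚ × ℚ | (heronCurve α n).Nonsingular p.1 p.2} =>
      (p.elim 0 fun q => .some q.1.1 q.1.2 q.2 : (heronCurve α n).Point)) ?_)
  rintro (_ | @⟨x, y, hp⟩)
  · exact ⟨none, rfl⟩
  · exact ⟨some ⟨(x, y), hp⟩, rfl⟩

theorem heronCurve_isElliptic (α : ℚ) {n : ℚ} (hn : n ≠ 0) : (heronCurve α n).IsElliptic := by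
  rw [WeierstrassCurve.isElliptic_iff, isUnit_iff_ne_zero]
  have : (heronCurve α n).Δ = 16 * n ^ 4 * (α ^ 2 + 4 * n ^ 2) := by
    simp only [WeierstrassCurve.Δ, WeierstrassCurve.b₂, WeierstrassCurve.b₄, WeierstrassCurve.b₆,
      WeierstrassCurve.b₈, heronCurve]
    ring
  rw [this]
  positivity

theorem addOrderOf_some_ne_two {α n x y : ℚ} (h : (heronCurve α n).Nonsingular x y) (hy : y ≠ 0) :
    addOrderOf (WeierstrassCurve.Affine.Point.some _ _ h) ≠ 2 := by
  intro h2
  have h0 := addOrderOf_nsmul_eq_zero (WeierstrassCurve.Affine.Point.some _ _ h)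
  rw [h2, two_nsmul, add_eq_zero_iff_eq_neg, WeierstrassCurve.Affine.Point.neg_some,
    WeierstrassCurve.Affine.Point.some.injEq] at h0
  have := h0.2
  simp only [WeierstrassCurve.Affine.negY, heronCurve] at this
  exact hy (by linarith)

theorem IsHeronQuadrilateral.points {Q : Polygon EPlane 4} {a b c d n : ℚ}
    (h : IsHeronQuadrilateral Q a b c d n) :
    (heronCurve (heronAlpha a b c d) n).IsElliptic ∧
      ∃ (h₁ : (heronCurve (heronAlpha a b c d) n).Nonsingular
            (heronX₁ a b c d) (heronY₁ a b c d))
        (h₂ : (heronCurve (heronAlpha a b c d) n).Nonsingular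
            (heronX₂ a b c d) (heronY₂ a b c d)),
        WeierstrassCurve.Affine.Point.some _ _ h₁ ≠ WeierstrassCurve.Affine.Point.some _ _ h₂ ∧
        addOrderOf (WeierstrassCurve.Affine.Point.some _ _ h₁) ≠ 2 ∧
        addOrderOf (WeierstrassCurve.Affine.Point.some _ _ h₂) ≠ 2 := by
  obtain ⟨hn, ha, hb, h1, h2, h3, h4, hbr⟩ := h.metric
  have hell := heronCurve_isElliptic (heronAlpha a b c d) hn.ne'
  have hn2 : n ^ 2 = (b + c + d - a) * (a + c + d - b) * (a + b + d - c) * (a + b + c - d) / 16 := by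
    linarith
  have hx₁ : 0 < ((a + c) ^ 2 - (b - d) ^ 2) / 4 := by
    have := mul_pos h2 h4
    linarith
  have hx₂ : 0 < ((a + d) ^ 2 - (b - c) ^ 2) / 4 := by
    have := mul_pos h2 h3
    linarith
  refine ⟨hell, WeierstrassCurve.Affine.equation_iff_nonsingular.1 ?_,
    WeierstrassCurve.Affine.equation_iff_nonsingular.1 ?_, ?_, ?_, ?_⟩
  · rw [WeierstrassCurve.Affine.equation_iff]
    simp only [heronCurve, heronX₁, heronY₁, heronAlpha, hn2]
    ring
  · rw [WeierstrassCurve.Affine.equation_iff]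
    simp only [heronCurve, heronX₂, heronY₂, heronAlpha, hn2]
    ring
  · intro he
    have := (WeierstrassCurve.Affine.Point.some.inj he).1
    simp only [heronX₁, heronX₂] at this
    linarith
  · exact addOrderOf_some_ne_two _ (mul_pos ha hx₁).ne'
  · exact addOrderOf_some_ne_two _ (mul_pos hb hx₂).ne'

/-- A slope `a` with `0 < a` and `a² < n` yields a Heron quadrilateral with two equal consecutive
sides `a`. -/
theorem exists_isHeronQuadrilateral {α n a : ℚ} (hn : 0 < n) (ha : a ∈ heronSlopes α n)
    (ha0 : 0 < a) (han : a ^ 2 < n) :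
    ∃ (Q : Polygon EPlane 4) (a b c d : ℚ),
      IsHeronQuadrilateral Q a b c d n ∧ heronAlpha a b c d = α := by
  obtain ⟨g, hg, hgα, -, hg2⟩ := exists_pos_of_mem_heronSlopes hn ha
  have hg0 : 0 < g := by linarith
  have hlt : 2 * a ^ 2 * |a ^ 2 - α| < g * g := by
    refine mul_lt_mul'' (by linarith) ?_ (by positivity) (abs_nonneg _) |>.trans_le le_rfl
    refine lt_of_le_of_ne hgα fun he => ?_
    rw [← he, sq_abs] at hg2
    have : 0 < n ^ 2 := by positivity
    linarith
  have key : |a * (a ^ 2 - α) / g| < g / (2 * a) := by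
    rw [abs_div, abs_mul, abs_of_pos ha0, abs_of_pos hg0, div_lt_div_iff₀ hg0 (by positivity)]
    linarith
  rw [abs_lt] at key
  -- With `c = p + q` and `d = p - q`, the value of `α` requires `2 p q = a² - α`; `p = g / (2a)`
  -- achieves this, and `w = n / p` gives area `n`.
  set c := g / (2 * a) + a * (a ^ 2 - α) / g with hc
  set d := g / (2 * a) - a * (a ^ 2 - α) / g with hd
  have hf : a ^ 2 + c * d = (g / (2 * a)) ^ 2 + (2 * a * n / g) ^ 2 := by
    have e : c * d = (g / (2 * a)) ^ 2 - a ^ 2 * (a ^ 2 - α) ^ 2 / g ^ 2 := by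
      rw [hc, hd]; field_simp; ring
    have e' : (a ^ 2 - α) ^ 2 = g ^ 2 - 4 * n ^ 2 := by linarith
    rw [e, e']
    field_simp
    ring
  obtain ⟨Q, hQ, da, db, dc, dd, harea⟩ := exists_cyclicQuadrilateral
    (a := a) (c := c) (d := d) (p := (g / (2 * a) : ℚ)) (w := (2 * a * n / g : ℚ))
    (by exact_mod_cast ha0) (by exact_mod_cast (by linarith : 0 < c))
    (by exact_mod_cast (by linarith : 0 < d))
    (by exact_mod_cast (by positivity : 0 < 2 * a * n / g))
    (by exact_mod_cast (by rw [hc, hd]; ring : c + d = 2 * (g / (2 * a))))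
    (by exact_mod_cast hf)
  refine ⟨Q, a, a, c, d, ⟨hQ, da, db, dc, dd, ?_⟩, ?_⟩
  · rw [harea, ← Rat.cast_mul]
    congr 1
    field_simp
  · rw [heronAlpha, hc, hd]
    field_simp
    ring

theorem theorem3p1 :
    (∀ (Q : Polygon EPlane 4) (a b c d n : ℚ), IsHeronQuadrilateral Q a b c d n →
      (heronCurve (heronAlpha a b c d) n).IsElliptic ∧
      ∃ (h₁ : (heronCurve (heronAlpha a b c d) n).Nonsingular
            (heronX₁ a b c d) (heronY₁ a b c d))
        (h₂ : (heronCurve (heronAlpha a b c d) n).Nonsingular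
            (heronX₂ a b c d) (heronY₂ a b c d)),
        WeierstrassCurve.Affine.Point.some _ _ h₁ ≠ WeierstrassCurve.Affine.Point.some _ _ h₂ ∧
        addOrderOf (WeierstrassCurve.Affine.Point.some _ _ h₁) ≠ 2 ∧
        addOrderOf (WeierstrassCurve.Affine.Point.some _ _ h₂) ≠ 2) ∧
    (∀ (α n : ℚ), 0 < n → (heronCurve α n).IsElliptic →
      0 < Module.rank ℤ (heronCurve α n).Point →
      ∃ (Q : Polygon EPlane 4) (a b c d : ℚ),
        IsHeronQuadrilateral Q a b c d n ∧ heronAlpha a b c d = α) := by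
  refine ⟨fun _ _ _ _ _ _ h => h.points, fun α n hn _ hrank => ?_⟩
  -- The threshold `min 1 n` gives `a² < a < n`.
  obtain ⟨a, ha, ha0, ha1⟩ := exists_small_mem_heronSlopes hn (lt_min one_pos hn)
    (infinite_heronSlopes hrank)
  refine exists_isHeronQuadrilateral hn ha ha0 ?_
  have h1 := ha1.trans_le (min_le_left _ _)
  have h2 := ha1.trans_le (min_le_right _ _)
  nlinarith
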